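/- Let $n \ge 0$ and let $\lambda \vdash n$ be a partition, identified with its Ferrers diagram. Let $f^{\lambda}$ be the number of standard tableaux of shape $\lambda$ (which is positive), and let $f^{\lambda/(3)}$ be the number of skew tableaux of shape $\lambda/(3)$, i.e. of fillings of the cells of $\lambda$ outside the one-row diagram $(3)$ with $1,\dots,n-3$, each used once, with increasing rows and columns; $f^{\lambda/(3)}=0$ if $\lambda$ does not contain $(3)$. The content of the cell $w$ in column $i$ and row $j$ is $c(w)=i-j$, and for a partition $\alpha=(\alpha_1,\dots,\alpha_l)$ put \[ cp^{\alpha}(\lambda)=\prod_{i=1}^{l}\ \sum_{w\in\lambda} c(w)^{\alpha_i-1}, \qquad 0^0=1. \] With $(n)_3=n(n-1)(n-2)$, one has \[ (n)_3\,\frac{f^{\lambda/(3)}}{f^{\lambda}} = \tfrac16\, cp^{(1,1,1)}(\lambda) + cp^{(2,1)}(\lambda) + cp^{(3)}(\lambda) - cp^{(1,1)}(\lambda) - 2\,cp^{(2)}(\lambda) + \tfrac56\, cp^{(1)}(\lambda). \] -/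

import Mathlib

/-- A standard filling of a finite set `D` of cells (a cell is a pair `(row, column)`, as in
Mathlib's `YoungDiagram`): the integers `1, …, |D|` are each used exactly once, and the entries
strictly increase along rows and along columns. The entry function is required to vanish outside `D`
so that two fillings are equal exactly when they agree on `D`. -/
@[ext]
structure StandardFilling (D : Finset (ℕ × ℕ)) where
  /-- `entry (i, j)` is the number in the cell in row `i` and column `j`. -/
  entry : ℕ × ℕ → ℕ
  bijOn : Set.BijOn entry (D : Set (ℕ × ℕ)) (Set.Icc 1 D.card)
  row_lt : ∀ {i j₁ j₂ : ℕ}, j₁ < j₂ → (i, j₁) ∈ D → (i, j₂) ∈ D → entry (i, j₁) < entry (i, j₂)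
  col_lt : ∀ {i₁ i₂ j : ℕ}, i₁ < i₂ → (i₁, j) ∈ D → (i₂, j) ∈ D → entry (i₁, j) < entry (i₂, j)
  zeros : ∀ {c : ℕ × ℕ}, c ∉ D → entry c = 0

/-- There are finitely many standard fillings, so `Nat.card` really counts them. -/
instance StandardFilling.instFinite (D : Finset (ℕ × ℕ)) : Finite (StandardFilling D) := by
  refine Finite.of_injective
    (fun (T : StandardFilling D) (c : D) =>
      (⟨T.entry c, Nat.lt_succ_of_le (T.bijOn.mapsTo c.2).2⟩ : Fin (D.card + 1))) ?_
  intro T T' h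
  ext c
  by_cases hc : c ∈ D
  · have := congrFun h ⟨c, hc⟩
    simpa using this
  · rw [T.zeros hc, T'.zeros hc]

/-- `f^λ`, the number of standard tableaux of shape `λ`. -/
noncomputable def numStandardTableaux (lam : YoungDiagram) : ℕ :=
  Nat.card (StandardFilling lam.cells)

open scoped Classical in
/-- `f^{λ/μ}`, the number of skew tableaux of shape `λ/μ`, i.e. of standard fillings of the cells of
`λ` that are not in `μ`. If `μ` is not contained in `λ` then `λ/μ` is not a skew partition and there
is no skew tableau of that shape. -/
noncomputable def numSkewTableaux (lam mu : YoungDiagram) : ℕ :=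
  if mu ≤ lam then Nat.card (StandardFilling (lam.cells \ mu.cells)) else 0

/-- The one-row partition `(k)`, with `k` cells in row `0`. -/
def oneRow (k : ℕ) : YoungDiagram :=
  YoungDiagram.ofRowLens [k] (by intro a b _; simp)

/-- The content of a cell, column index minus row index. -/
def content (w : ℕ × ℕ) : ℤ := (w.2 : ℤ) - (w.1 : ℤ)

/-- The relative content `c_a(w) = c(w) - c(a)`, with `a` taken as the origin. -/
def relContent (a w : ℕ × ℕ) : ℤ := content w - content a

/-- `cp^α_a(C) = ∏ᵢ ∑_{w ∈ C} c_a(w)^(αᵢ - 1)` for a partition `α = (α₁, …, α_l)` (given as the list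
of its parts, which are positive), with the convention `0^0 = 1`. -/
def cpAt (α : List ℕ) (a : ℕ × ℕ) (C : Finset (ℕ × ℕ)) : ℤ :=
  (α.map fun k => ∑ w ∈ C, relContent a w ^ (k - 1)).prod

/-- The content power sum `cp^α(λ)`. For every standard tableau `T` of shape `λ`, the only tree of
the trace forest of `T` has all the cells of `λ` as its vertices and the corner cell `(0, 0)` as its
root, so that this is `cp^α` of that tree. -/
def cp (α : List ℕ) (lam : YoungDiagram) : ℤ := cpAt α (0, 0) lam.cells

/-! Both sides obey the same recursion under removal of a corner. Deleting the largest entry gives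
`numSkewTableaux_eq_sum_removeCorner`: away from `mu = lam`, the count for `lam` is the sum of the
counts for the diagrams `lam⁻` with one corner less. The case `mu = ⊥` is the recursion for f^λ.

With beta numbers l_i = λ_i + N - 1 - i, removing the corner of row i multiplies ∏_{a<b}(l_a -
l_b)/∏ l_a! by w_i = l_i ∏_{j≠i}(1 - 1/(l_i - l_j)), which vanishes when row i has no corner. Since
∑ w_i = n, induction yields Frobenius' formula for f^λ up to a constant, hence n f^{λ⁻} = w_i f^λ
(`card_mul_numStandardTableaux_removeCorner`).

The corner of row i has content c_i = l_i - N. Partial fractions evaluate ∑ w_i c_i^k for k = 0, 1,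
2 as n, 2p₁ and 3p₂ - n(n-1)/2, where p_k is the k-th power sum of the contents. As the change of
the polynomial P on the right-hand side involves only 1, c_i and c_i², these three sums give n ∑
f^{λ⁻} P(λ⁻) = (n-3) f^λ P(λ) (`card_mul_sum_threeRowPoly`). The quantity (n)₃ f^{λ/(3)} satisfies
the same relation. Its factor n - 3 can be cancelled except at n = 3, where the shapes are checked
directly. -/

/-! ### Partial fractions and moments of the shift weights -/

section InterpolationMoments

variable {ι : Type*} [DecidableEq ι]

/-- The product `∏ (1 - 1 / (l i - l j))` over all `j ∈ s` different from `i`. -/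
def shiftWeight (l : ι → ℚ) (s : Finset ι) (i : ι) : ℚ :=
  ∏ j ∈ s.erase i, (1 - 1 / (l i - l j))

theorem shiftWeight_insert_of_mem (l : ι → ℚ) {s : Finset ι} {a i : ι} (ha : a ∉ s)
    (hi : i ∈ s) :
    shiftWeight l (insert a s) i = shiftWeight l s i * (1 - 1 / (l i - l a)) := by
  have hai : a ≠ i := fun h => ha (h ▸ hi)
  rw [shiftWeight, Finset.erase_insert_of_ne hai, Finset.prod_insert (by simp [ha]), mul_comm,
    shiftWeight]

theorem shiftWeight_insert_self (l : ι → ℚ) {s : Finset ι} {a : ι} (ha : a ∉ s) :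
    shiftWeight l (insert a s) a = ∏ j ∈ s, (1 - 1 / (l a - l j)) := by
  rw [shiftWeight, Finset.erase_insert ha]

/-- Partial fraction expansion of `∏ (1 - 1 / (z - l j))`. -/
theorem prod_one_sub_inv (l : ι → ℚ) (s : Finset ι) (hl : Set.InjOn l s) (z : ℚ)
    (hz : ∀ i ∈ s, z ≠ l i) :
    ∏ j ∈ s, (1 - 1 / (z - l j)) = 1 - ∑ i ∈ s, shiftWeight l s i / (z - l i) := by
  induction s using Finset.induction_on generalizing z with
  | empty => simp
  | insert a s ha ih =>
    have hl' : Set.InjOn l s := hl.mono (by simp)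
    have hne : ∀ i ∈ s, l a ≠ l i := fun i hi h =>
      ha ((hl (by simp) (by simp [hi]) h : a = i) ▸ hi)
    have hza : z - l a ≠ 0 := sub_ne_zero.2 (hz a (by simp))
    -- Splitting 1/((z - l i)(l i - l a)) into simple fractions produces the same kind of sum at `z`
    -- and at `l a`; the induction hypothesis is used at both points, so `z` has to be generalized.
    have hterm : ∀ i ∈ s, shiftWeight l (insert a s) i / (z - l i) =
        shiftWeight l s i / (z - l i) +
          1 / (z - l a) * (shiftWeight l s i / (l a - l i) - shiftWeight l s i / (z - l i)) := by
      intro i hi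
      have h1 : z - l i ≠ 0 := sub_ne_zero.2 (hz i (by simp [hi]))
      have h2 : l a - l i ≠ 0 := sub_ne_zero.2 (hne i hi)
      have h3 : l i - l a ≠ 0 := sub_ne_zero.2 (hne i hi).symm
      rw [shiftWeight_insert_of_mem l ha hi]
      field_simp
      ring
    rw [Finset.prod_insert ha, Finset.sum_insert ha, shiftWeight_insert_self l ha,
      Finset.sum_congr rfl hterm, Finset.sum_add_distrib, ← Finset.mul_sum,
      Finset.sum_sub_distrib, ih hl' z (fun i hi => hz i (by simp [hi])), ih hl' (l a) hne]
    field_simp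
    ring

/-- In l_i^k/(l_i - l_a), write l_i^k = (l_i^k - l_a^k) + l_a^k. The first part is a geometric sum
and gives moments of degree below k; the second, added to the new term at `a`, collapses to l_a^k by
`prod_one_sub_inv` at z = l_a. -/
theorem sum_pow_mul_shiftWeight_insert (l : ι → ℚ) {s : Finset ι} {a : ι} (ha : a ∉ s)
    (hl : Set.InjOn l (insert a s : Finset ι)) (k : ℕ) :
    ∑ i ∈ insert a s, l i ^ k * shiftWeight l (insert a s) i =
      ∑ i ∈ s, l i ^ k * shiftWeight l s i + l a ^ k
        - ∑ b ∈ Finset.range k,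
            l a ^ (k - 1 - b) * ∑ i ∈ s, l i ^ b * shiftWeight l s i := by
  have hl' : Set.InjOn l s := hl.mono (by simp)
  have hne : ∀ i ∈ s, l a ≠ l i := fun i hi h =>
    ha ((hl (by simp) (by simp [hi]) h : a = i) ▸ hi)
  have hterm : ∀ i ∈ s, l i ^ k * shiftWeight l (insert a s) i =
      l i ^ k * shiftWeight l s i - (∑ b ∈ Finset.range k, l i ^ b * l a ^ (k - 1 - b)) *
        shiftWeight l s i + l a ^ k * (shiftWeight l s i / (l a - l i)) := by
    intro i hi
    have h2 : l a - l i ≠ 0 := sub_ne_zero.2 (hne i hi)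
    have h3 : l i - l a ≠ 0 := sub_ne_zero.2 (hne i hi).symm
    have hg : ∑ b ∈ Finset.range k, l i ^ b * l a ^ (k - 1 - b) =
        (l i ^ k - l a ^ k) / (l i - l a) := by
      rw [eq_div_iff h3, (Commute.all _ _).geom_sum₂_mul]
    rw [shiftWeight_insert_of_mem l ha hi, hg]
    field_simp
    ring
  rw [Finset.sum_insert ha, shiftWeight_insert_self l ha, prod_one_sub_inv l s hl' _ hne,
    Finset.sum_congr rfl hterm, Finset.sum_add_distrib, Finset.sum_sub_distrib, ← Finset.mul_sum]
  have hswap : ∑ i ∈ s, (∑ b ∈ Finset.range k, l i ^ b * l a ^ (k - 1 - b)) * shiftWeight l s i =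
      ∑ b ∈ Finset.range k, l a ^ (k - 1 - b) * ∑ i ∈ s, l i ^ b * shiftWeight l s i := by
    simp_rw [Finset.sum_mul, Finset.mul_sum]
    rw [Finset.sum_comm]
    exact Finset.sum_congr rfl fun b _ => Finset.sum_congr rfl fun i _ => by ring
  rw [hswap]
  ring

/-- The moments of degree 0 to 3 come from the insertion formula by induction on `s`, each from the
lower ones. Degree 3 is reached because a corner weight carries an extra factor l_i in front of
c_i². -/
theorem sum_shiftWeight (l : ι → ℚ) (s : Finset ι) (hl : Set.InjOn l s) :
    ∑ i ∈ s, shiftWeight l s i = s.card := by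
  induction s using Finset.induction_on with
  | empty => simp
  | insert a s ha ih =>
    have h := sum_pow_mul_shiftWeight_insert l ha hl 0
    simp only [pow_zero, one_mul, Finset.range_zero, Finset.sum_empty, sub_zero] at h
    rw [h, ih (hl.mono (by simp)), Finset.card_insert_of_notMem ha]
    push_cast
    ring

theorem sum_mul_shiftWeight (l : ι → ℚ) (s : Finset ι) (hl : Set.InjOn l s) :
    ∑ i ∈ s, l i * shiftWeight l s i = ∑ i ∈ s, l i - (s.card : ℚ) * (s.card - 1) / 2 := by
  induction s using Finset.induction_on with
  | empty => simp
  | insert a s ha ih =>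
    have hl' : Set.InjOn l s := hl.mono (by simp)
    have h := sum_pow_mul_shiftWeight_insert l ha hl 1
    simp only [Finset.sum_range_succ, Finset.range_zero, Finset.sum_empty, pow_one, pow_zero,
      one_mul, sum_shiftWeight l s hl'] at h
    rw [h, ih hl', Finset.card_insert_of_notMem ha, Finset.sum_insert ha]
    push_cast
    ring

theorem sum_sq_mul_shiftWeight (l : ι → ℚ) (s : Finset ι) (hl : Set.InjOn l s) :
    ∑ i ∈ s, l i ^ 2 * shiftWeight l s i =
      ∑ i ∈ s, l i ^ 2 - ((s.card : ℚ) - 1) * ∑ i ∈ s, l i +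
        (s.card : ℚ) * (s.card - 1) * (s.card - 2) / 6 := by
  induction s using Finset.induction_on with
  | empty => simp
  | insert a s ha ih =>
    have hl' : Set.InjOn l s := hl.mono (by simp)
    have h := sum_pow_mul_shiftWeight_insert l ha hl 2
    simp only [Finset.sum_range_succ, Finset.range_zero, Finset.sum_empty, pow_one, pow_zero,
      one_mul, sum_shiftWeight l s hl', sum_mul_shiftWeight l s hl', ih hl'] at h
    rw [h, Finset.card_insert_of_notMem ha, Finset.sum_insert ha, Finset.sum_insert ha]
    push_cast
    ring

theorem sum_cube_mul_shiftWeight (l : ι → ℚ) (s : Finset ι) (hl : Set.InjOn l s) :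
    ∑ i ∈ s, l i ^ 3 * shiftWeight l s i =
      ∑ i ∈ s, l i ^ 3 - ((s.card : ℚ) - 1) * ∑ i ∈ s, l i ^ 2
        - ((∑ i ∈ s, l i) ^ 2 - ∑ i ∈ s, l i ^ 2) / 2
        + ((s.card : ℚ) - 1) * (s.card - 2) / 2 * ∑ i ∈ s, l i
        - (s.card : ℚ) * (s.card - 1) * (s.card - 2) * (s.card - 3) / 24 := by
  induction s using Finset.induction_on with
  | empty => simp
  | insert a s ha ih =>
    have hl' : Set.InjOn l s := hl.mono (by simp)
    have h := sum_pow_mul_shiftWeight_insert l ha hl 3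
    simp only [Finset.sum_range_succ, Finset.range_zero, Finset.sum_empty, pow_one, pow_zero,
      one_mul, sum_shiftWeight l s hl', sum_mul_shiftWeight l s hl',
      sum_sq_mul_shiftWeight l s hl', ih hl'] at h
    rw [h, Finset.card_insert_of_notMem ha]
    simp only [Finset.sum_insert ha]
    push_cast
    ring

/-- The product of the differences `l a - l b` over all pairs `a < b` of elements of `s`. -/
def diffProd (l : ℕ → ℚ) (s : Finset ℕ) : ℚ :=
  ∏ a ∈ s, ∏ b ∈ s, if a < b then l a - l b else 1

/-- Only pairs containing `i` change, and the pair {i, j} gains the factor 1 - 1/(l_i - l_j)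
whichever of the two indices is smaller. -/
theorem diffProd_update_sub_one (l : ℕ → ℚ) (s : Finset ℕ) (hl : Set.InjOn l s) {i : ℕ}
    (hi : i ∈ s) :
    diffProd (Function.update l i (l i - 1)) s = diffProd l s * shiftWeight l s i := by
  have key : ∀ a ∈ s, ∀ b ∈ s,
      (if a < b then Function.update l i (l i - 1) a - Function.update l i (l i - 1) b else 1) =
        (if a < b then l a - l b else 1) *
          ((if a = i then if i < b then 1 - 1 / (l i - l b) else 1 else 1) *
            (if b = i then if a < i then 1 - 1 / (l i - l a) else 1 else 1)) := by
    intro a ha b hb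
    have hne : ∀ j ∈ s, j ≠ i → l i - l j ≠ 0 := fun j hj hji =>
      sub_ne_zero.2 fun h => hji (hl hi hj h).symm
    rcases lt_or_ge a b with hab | hab
    · by_cases h1 : a = i
      · subst h1
        have := hne b hb hab.ne'
        simp only [hab, hab.ne', if_true, if_false, Function.update_self,
          Function.update_of_ne hab.ne']
        field_simp
        ring
      · by_cases h2 : b = i
        · subst h2
          have := hne a ha hab.ne
          simp only [hab, h1, if_true, if_false, Function.update_self,
            Function.update_of_ne h1]
          field_simp
          ring
        · simp [hab, h1, h2]
    · by_cases h1 : a = i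
      · subst h1
        by_cases h2 : b = a <;> simp [hab.not_gt, h2]
      · by_cases h2 : b = i
        · subst h2; simp [hab.not_gt, h1]
        · simp [hab.not_gt, h1, h2]
  rw [diffProd, Finset.prod_congr rfl fun a ha => Finset.prod_congr rfl (key a ha)]
  simp only [Finset.prod_mul_distrib]
  rw [diffProd, shiftWeight]
  congr 1
  have h1 : ∏ a ∈ s, ∏ b ∈ s, (if a = i then if i < b then 1 - 1 / (l i - l b) else 1 else 1) =
      ∏ b ∈ s, if i < b then 1 - 1 / (l i - l b) else 1 := by
    rw [Finset.prod_comm]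
    exact Finset.prod_congr rfl fun b _ => by rw [Finset.prod_ite_eq' s i]; simp [hi]
  have h2 : ∏ a ∈ s, ∏ b ∈ s, (if b = i then if a < i then 1 - 1 / (l i - l a) else 1 else 1) =
      ∏ a ∈ s, if a < i then 1 - 1 / (l i - l a) else 1 :=
    Finset.prod_congr rfl fun b _ => by rw [Finset.prod_ite_eq' s i]; simp [hi]
  rw [h1, h2, ← Finset.prod_mul_distrib, ← Finset.mul_prod_erase s _ hi]
  simp only [lt_irrefl, if_false, one_mul]
  refine Finset.prod_congr rfl fun j hj => ?_
  rcases lt_or_gt_of_ne (Finset.ne_of_mem_erase hj) with h | h <;> simp [h, h.not_gt]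

end InterpolationMoments

/-! ### Standard fillings and deletion of the largest entry -/

/-- The cells of `D` that have no cell of `D` to their right or below. -/
def outerCells (D : Finset (ℕ × ℕ)) : Finset (ℕ × ℕ) :=
  D.filter fun c => ∀ d ∈ D, (d.1 = c.1 → d.2 ≤ c.2) ∧ (d.2 = c.2 → d.1 ≤ c.1)

namespace StandardFilling

variable {D : Finset (ℕ × ℕ)}

theorem entry_le (T : StandardFilling D) (c : ℕ × ℕ) : T.entry c ≤ D.card := by
  by_cases hc : c ∈ D
  · exact (T.bijOn.mapsTo hc).2
  · simp [T.zeros hc]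

/-- Extend a filling of `D` minus an outer cell by putting the largest entry in that cell. -/
def insertMax {c : ℕ × ℕ} (hc : c ∈ outerCells D) (T : StandardFilling (D.erase c)) :
    StandardFilling D where
  entry := Function.update T.entry c D.card
  bijOn := by
    have hcD : c ∈ D := (Finset.mem_filter.1 hc).1
    have hcard : (D.erase c).card + 1 = D.card := Finset.card_erase_add_one hcD
    refine ⟨fun d hd => ?_, fun d hd e he h => ?_, fun k hk => ?_⟩
    · by_cases hdc : d = c
      · have := Finset.card_pos.2 ⟨c, hcD⟩
        rw [hdc, Function.update_self]
        exact ⟨this, le_rfl⟩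
      · have := T.bijOn.mapsTo (show d ∈ (D.erase c : Set _) by simpa [hdc] using hd)
        simp only [Function.update_of_ne hdc, Set.mem_Icc] at this ⊢
        omega
    · by_cases hdc : d = c <;> by_cases hec : e = c
      · rw [hdc, hec]
      · have := T.entry_le e
        rw [hdc, Function.update_self, Function.update_of_ne hec] at h
        omega
      · have := T.entry_le d
        rw [hec, Function.update_self, Function.update_of_ne hdc] at h
        omega
      · rw [Function.update_of_ne hdc, Function.update_of_ne hec] at h
        exact T.bijOn.injOn (by simpa [hdc] using hd) (by simpa [hec] using he) h
    · by_cases hk' : k = D.card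
      · exact ⟨c, hcD, by simp [hk']⟩
      · obtain ⟨d, hd, rfl⟩ := T.bijOn.surjOn (show k ∈ Set.Icc 1 (D.erase c).card by
          simp only [Set.mem_Icc] at hk ⊢; omega)
        have hd' := Finset.mem_erase.1 (Finset.mem_coe.1 hd)
        exact ⟨d, hd'.2, by rw [Function.update_of_ne hd'.1]⟩
  row_lt := by
    intro i j₁ j₂ hj h1 h2
    obtain ⟨hcD, hcm⟩ := Finset.mem_filter.1 hc
    have hcard : (D.erase c).card + 1 = D.card := Finset.card_erase_add_one hcD
    have hne : (i, j₁) ≠ c := by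
      rintro rfl
      exact absurd ((hcm _ h2).1 rfl) (by simpa using hj)
    rw [Function.update_of_ne hne]
    by_cases h2c : (i, j₂) = c
    · rw [h2c, Function.update_self]
      have := T.entry_le (i, j₁)
      omega
    · rw [Function.update_of_ne h2c]
      exact T.row_lt hj (by simp [hne, h1]) (by simp [h2c, h2])
  col_lt := by
    intro i₁ i₂ j hj h1 h2
    obtain ⟨hcD, hcm⟩ := Finset.mem_filter.1 hc
    have hcard : (D.erase c).card + 1 = D.card := Finset.card_erase_add_one hcD
    have hne : (i₁, j) ≠ c := by
      rintro rfl
      exact absurd ((hcm _ h2).2 rfl) (by simpa using hj)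
    rw [Function.update_of_ne hne]
    by_cases h2c : (i₂, j) = c
    · rw [h2c, Function.update_self]
      have := T.entry_le (i₁, j)
      omega
    · rw [Function.update_of_ne h2c]
      exact T.col_lt hj (by simp [hne, h1]) (by simp [h2c, h2])
  zeros := by
    intro d hd
    have hne : d ≠ c := by
      rintro rfl
      exact hd (Finset.mem_filter.1 hc).1
    rw [Function.update_of_ne hne]
    exact T.zeros fun h => hd (Finset.mem_of_mem_erase h)

/-- Remove from a standard filling the cell with the largest entry. -/
def eraseMax (T : StandardFilling D) {c : ℕ × ℕ} (hcD : c ∈ D) (hc : T.entry c = D.card) :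
    StandardFilling (D.erase c) where
  entry := Function.update T.entry c 0
  bijOn := by
    have hcard : (D.erase c).card + 1 = D.card := Finset.card_erase_add_one hcD
    refine ⟨fun d hd => ?_, fun d hd e he h => ?_, fun k hk => ?_⟩
    · obtain ⟨hdc, hd⟩ := Finset.mem_erase.1 (Finset.mem_coe.1 hd)
      have h1 := T.bijOn.mapsTo (Finset.mem_coe.2 hd)
      have h2 : T.entry d ≠ D.card := fun h => hdc (T.bijOn.injOn hd hcD (h.trans hc.symm))
      simp only [Function.update_of_ne hdc, Set.mem_Icc] at h1 ⊢
      omega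
    · obtain ⟨hdc, hd⟩ := Finset.mem_erase.1 (Finset.mem_coe.1 hd)
      obtain ⟨hec, he⟩ := Finset.mem_erase.1 (Finset.mem_coe.1 he)
      rw [Function.update_of_ne hdc, Function.update_of_ne hec] at h
      exact T.bijOn.injOn hd he h
    · simp only [Set.mem_Icc] at hk
      obtain ⟨d, hd, rfl⟩ := T.bijOn.surjOn (show k ∈ Set.Icc 1 D.card by
        simp only [Set.mem_Icc]; omega)
      have hdc : d ≠ c := by rintro rfl; omega
      exact ⟨d, by simpa [hdc] using hd, by rw [Function.update_of_ne hdc]⟩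
  row_lt := by
    intro i j₁ j₂ hj h1 h2
    obtain ⟨h1c, h1⟩ := Finset.mem_erase.1 h1
    obtain ⟨h2c, h2⟩ := Finset.mem_erase.1 h2
    rw [Function.update_of_ne h1c, Function.update_of_ne h2c]
    exact T.row_lt hj h1 h2
  col_lt := by
    intro i₁ i₂ j hj h1 h2
    obtain ⟨h1c, h1⟩ := Finset.mem_erase.1 h1
    obtain ⟨h2c, h2⟩ := Finset.mem_erase.1 h2
    rw [Function.update_of_ne h1c, Function.update_of_ne h2c]
    exact T.col_lt hj h1 h2
  zeros := by
    intro d hd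
    by_cases hdc : d = c
    · rw [hdc, Function.update_self]
    · rw [Function.update_of_ne hdc]
      exact T.zeros fun h => hd (Finset.mem_erase.2 ⟨hdc, h⟩)

theorem mem_outerCells (T : StandardFilling D) {c : ℕ × ℕ} (hcD : c ∈ D)
    (hc : T.entry c = D.card) : c ∈ outerCells D := by
  refine Finset.mem_filter.2 ⟨hcD, fun d hd => ⟨fun h => ?_, fun h => ?_⟩⟩
  · by_contra! hlt
    obtain ⟨c1, c2⟩ := c
    obtain ⟨d1, d2⟩ := d
    obtain rfl : d1 = c1 := h
    have : T.entry (d1, c2) < T.entry (d1, d2) := T.row_lt hlt hcD hd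
    have := T.entry_le (d1, d2)
    omega
  · by_contra! hlt
    obtain ⟨c1, c2⟩ := c
    obtain ⟨d1, d2⟩ := d
    obtain rfl : d2 = c2 := h
    have : T.entry (c1, d2) < T.entry (d1, d2) := T.col_lt hlt hcD hd
    have := T.entry_le (d1, d2)
    omega

/-- The largest entry sits in an outer cell, and any outer cell can receive it. The empty set is
excluded: it has one filling but no outer cell. -/
theorem card_eq_sum_erase (hD : D.Nonempty) :
    Nat.card (StandardFilling D) =
      ∑ c ∈ outerCells D, Nat.card (StandardFilling (D.erase c)) := by
  rw [← Finset.sum_coe_sort, ← Nat.card_sigma]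
  symm
  refine Nat.card_eq_of_bijective
    (fun p : Σ c : outerCells D, StandardFilling (D.erase c) => insertMax p.1.2 p.2) ⟨?_, ?_⟩
  · rintro ⟨⟨c, hc⟩, T⟩ ⟨⟨c', hc'⟩, T'⟩ h
    have he : Function.update T.entry c D.card = Function.update T'.entry c' D.card :=
      congrArg StandardFilling.entry h
    have hcard : (D.erase c').card + 1 = D.card :=
      Finset.card_erase_add_one (Finset.mem_filter.1 hc').1
    -- The cell is recovered as the one with entry |D|, a value that a filling of |D| - 1 cells
    -- never takes.
    have hcc : c = c' := by
      by_contra hne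
      have h1 := congrFun he c
      rw [Function.update_self, Function.update_of_ne hne] at h1
      have : T'.entry c ≤ (D.erase c').card := T'.entry_le c
      omega
    subst hcc
    congr 1
    ext d
    by_cases hd : d = c
    · rw [hd, T.zeros (by simp), T'.zeros (by simp)]
    · simpa [Function.update_of_ne hd] using congrFun he d
  · intro T
    obtain ⟨c, hcD, hc⟩ := T.bijOn.surjOn
      (show D.card ∈ Set.Icc 1 D.card from ⟨hD.card_pos, le_rfl⟩)
    refine ⟨⟨⟨c, T.mem_outerCells hcD hc⟩, T.eraseMax hcD hc⟩, ?_⟩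
    ext d
    by_cases hd : d = c
    · simp [insertMax, hd, hc]
    · simp [insertMax, eraseMax, hd]

theorem card_empty : Nat.card (StandardFilling ∅) = 1 := by
  rw [Nat.card_eq_one_iff_unique]
  refine ⟨⟨fun T T' => ?_⟩, ⟨⟨fun _ => 0, by simp, by simp, by simp, by simp⟩⟩⟩
  ext d
  rw [T.zeros (by simp), T'.zeros (by simp)]

end StandardFilling

/-! ### Removing corners of a diagram -/

namespace YoungDiagram

/-- The diagram obtained by removing the last cell of row `i`, if this leaves a diagram; otherwise
the diagram itself. -/
def removeCorner (lam : YoungDiagram) (i : ℕ) : YoungDiagram :=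
  if h : lam.rowLen (i + 1) < lam.rowLen i then
    { cells := lam.cells.erase (i, lam.rowLen i - 1)
      isLowerSet := by
        rintro ⟨a, b⟩ ⟨c, d⟩ hle hab
        simp only [Prod.mk_le_mk] at hle
        simp only [Finset.coe_erase, Set.mem_sdiff, Finset.mem_coe, mem_cells,
          Set.mem_singleton_iff, Prod.mk.injEq, mem_iff_lt_rowLen] at hab ⊢
        have h1 := lam.rowLen_anti c a hle.1
        refine ⟨by omega, fun hcd => hab.2 ?_⟩
        have h2 : ¬ i + 1 ≤ a := fun hia => by
          have := lam.rowLen_anti (i + 1) a hia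
          omega
        have : a = i := by omega
        subst this
        omega }
  else lam

/-- The rows among the first `N` whose last cell can be removed. -/
def cornerRows (lam : YoungDiagram) (N : ℕ) : Finset ℕ :=
  (Finset.range N).filter fun i => lam.rowLen (i + 1) < lam.rowLen i

variable {lam : YoungDiagram} {N i : ℕ}

theorem mem_cornerRows :
    i ∈ lam.cornerRows N ↔ i < N ∧ lam.rowLen (i + 1) < lam.rowLen i := by
  simp [cornerRows]

theorem cells_removeCorner (h : lam.rowLen (i + 1) < lam.rowLen i) :
    (lam.removeCorner i).cells = lam.cells.erase (i, lam.rowLen i - 1) := by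
  rw [removeCorner, dif_pos h]

theorem corner_mem (h : lam.rowLen (i + 1) < lam.rowLen i) : (i, lam.rowLen i - 1) ∈ lam := by
  rw [mem_iff_lt_rowLen]
  omega

theorem card_removeCorner_add_one (h : lam.rowLen (i + 1) < lam.rowLen i) :
    (lam.removeCorner i).card + 1 = lam.card := by
  rw [YoungDiagram.card, cells_removeCorner h]
  exact Finset.card_erase_add_one ((mem_cells _).2 (corner_mem h))

theorem removeCorner_le : lam.removeCorner i ≤ lam := by
  by_cases h : lam.rowLen (i + 1) < lam.rowLen i
  · rw [← cells_subset_iff, cells_removeCorner h]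
    exact Finset.erase_subset _ _
  · rw [removeCorner, dif_neg h]

theorem rowLen_removeCorner (h : lam.rowLen (i + 1) < lam.rowLen i) :
    (lam.removeCorner i).rowLen = Function.update lam.rowLen i (lam.rowLen i - 1) := by
  have key : ∀ a b, b < (lam.removeCorner i).rowLen a ↔
      b < Function.update lam.rowLen i (lam.rowLen i - 1) a := by
    intro a b
    rw [← mem_iff_lt_rowLen, ← mem_cells, cells_removeCorner h, Finset.mem_erase, mem_cells,
      mem_iff_lt_rowLen]
    by_cases ha : a = i
    · subst ha
      simp
      omega
    · simp [ha]
  funext a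
  have h1 := key a ((lam.removeCorner i).rowLen a)
  have h2 := key a (Function.update lam.rowLen i (lam.rowLen i - 1) a)
  omega

end YoungDiagram

open YoungDiagram in
-- The outer cells of λ/μ are the corners of λ outside μ. A corner inside μ contributes 0, since μ
-- is not contained in what remains after its removal. Equality of the diagrams is excluded because
-- λ/λ is empty.
theorem numSkewTableaux_eq_sum_removeCorner {lam mu : YoungDiagram} {N : ℕ}
    (hN : lam.rowLen N = 0) (hne : mu ≠ lam) :
    numSkewTableaux lam mu =
      ∑ i ∈ lam.cornerRows N, numSkewTableaux (lam.removeCorner i) mu := by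
  by_cases hle : mu ≤ lam
  swap
  · rw [numSkewTableaux, if_neg hle]
    exact (Finset.sum_eq_zero fun i _ => if_neg fun h => hle (h.trans removeCorner_le)).symm
  have hD : (lam.cells \ mu.cells).Nonempty := by
    rw [Finset.sdiff_nonempty, cells_subset_iff]
    exact fun h => hne (le_antisymm hle h)
  rw [numSkewTableaux, if_pos hle, StandardFilling.card_eq_sum_erase hD,
    ← Finset.sum_filter_of_ne (s := lam.cornerRows N)
      (p := fun i => (i, lam.rowLen i - 1) ∉ mu.cells)]
  swap
  · intro i hi h hmem
    have hi := (mem_cornerRows.1 hi).2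
    refine h (if_neg fun hmu => ?_)
    have := cells_subset_iff.2 hmu hmem
    rw [cells_removeCorner hi] at this
    simp at this
  have hcorner : ∀ c ∈ outerCells (lam.cells \ mu.cells),
      c ∉ mu.cells ∧ c.1 < N ∧ lam.rowLen (c.1 + 1) < lam.rowLen c.1 ∧
        c = (c.1, lam.rowLen c.1 - 1) := by
    rintro ⟨a, b⟩ hc
    obtain ⟨hc, hmax⟩ := Finset.mem_filter.1 hc
    obtain ⟨h1, h2⟩ := Finset.mem_sdiff.1 hc
    rw [mem_cells, mem_iff_lt_rowLen] at h1
    -- Cells of λ below or to the right of a cell outside μ are outside μ too, so an outer cell of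
    -- λ/μ is maximal in λ itself.
    have hmem : ∀ d : ℕ × ℕ, (a, b) ≤ d → d ∈ lam → d ∈ lam.cells \ mu.cells := fun d hd hdl =>
      Finset.mem_sdiff.2 ⟨hdl, fun hdm => h2 (mu.isLowerSet hd hdm)⟩
    refine ⟨h2, ?_, ?_, ?_⟩
    · by_contra! h
      have := lam.rowLen_anti N a h
      omega
    · by_contra! h
      have := (hmax (a + 1, b) (hmem _ (by simp) (by
        rw [mem_iff_lt_rowLen]; simp only at h; omega))).2 rfl
      simp at this
    · have := (hmax (a, lam.rowLen a - 1) (hmem _ (by simp; omega) (by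
        rw [mem_iff_lt_rowLen]; omega))).1 rfl
      simp only [Prod.mk.injEq, true_and] at this ⊢
      omega
  refine Finset.sum_nbij' Prod.fst (fun i => (i, lam.rowLen i - 1)) ?_ ?_ ?_ ?_ ?_
  · intro c hc
    obtain ⟨h1, h2, h3, h4⟩ := hcorner c hc
    rw [Finset.mem_filter, mem_cornerRows, ← h4]
    exact ⟨⟨h2, h3⟩, h1⟩
  · intro i hi
    obtain ⟨hi, hmu⟩ := Finset.mem_filter.1 hi
    have hi := (mem_cornerRows.1 hi).2
    refine Finset.mem_filter.2 ⟨Finset.mem_sdiff.2 ⟨corner_mem hi, hmu⟩, ?_⟩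
    rintro ⟨a, b⟩ hd
    have hd := (Finset.mem_sdiff.1 hd).1
    rw [mem_cells, mem_iff_lt_rowLen] at hd
    refine ⟨?_, ?_⟩
    · rintro rfl
      exact Nat.le_sub_one_of_lt hd
    · rintro rfl
      by_contra! h
      have := lam.rowLen_anti (i + 1) a h
      omega
  · intro c hc
    exact (hcorner c hc).2.2.2.symm
  · intro i _
    rfl
  · intro c hc
    obtain ⟨h1, h2, h3, h4⟩ := hcorner c hc
    have hcells : (lam.removeCorner c.1).cells = lam.cells.erase c := by
      rw [cells_removeCorner h3, ← h4]
    have hle' : mu ≤ lam.removeCorner c.1 := by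
      rw [← cells_subset_iff, hcells]
      exact Finset.subset_erase.2 ⟨cells_subset_iff.2 hle, h1⟩
    rw [numSkewTableaux, if_pos hle', hcells, Finset.erase_sdiff_comm]

theorem numSkewTableaux_bot (lam : YoungDiagram) :
    numSkewTableaux lam ⊥ = numStandardTableaux lam := by
  rw [numSkewTableaux, if_pos bot_le, numStandardTableaux, YoungDiagram.cells_bot,
    Finset.sdiff_empty]

/-! ### Beta numbers and corner weights -/

namespace YoungDiagram

/-- The beta number of row `i` of a diagram regarded as having `N` rows. -/
def betaNum (lam : YoungDiagram) (N i : ℕ) : ℕ := lam.rowLen i + (N - 1 - i)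

/-- The quotient `∏_{a < b} (l_a - l_b) / ∏ l_a!` formed from the beta numbers `l_a`. -/
def betaQuotient (lam : YoungDiagram) (N : ℕ) : ℚ :=
  diffProd (fun i => (lam.betaNum N i : ℚ)) (Finset.range N) /
    ∏ i ∈ Finset.range N, ((lam.betaNum N i).factorial : ℚ)

/-- The factor by which the beta quotient changes when the last cell of row `i` is removed. -/
def cornerWeight (lam : YoungDiagram) (N i : ℕ) : ℚ :=
  lam.betaNum N i * shiftWeight (fun i => (lam.betaNum N i : ℚ)) (Finset.range N) i

variable {lam : YoungDiagram} {N i : ℕ}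

theorem betaNum_lt {a b : ℕ} (hab : a < b) (hb : b < N) :
    lam.betaNum N b < lam.betaNum N a := by
  have := lam.rowLen_anti a b hab.le
  unfold betaNum
  omega

theorem betaNum_injOn (lam : YoungDiagram) (N : ℕ) :
    Set.InjOn (fun i => (lam.betaNum N i : ℚ)) (Finset.range N : Finset ℕ) := by
  intro a ha b hb h
  have h : lam.betaNum N a = lam.betaNum N b := Nat.cast_injective h
  rcases lt_trichotomy a b with hab | hab | hab
  · exact absurd h (betaNum_lt hab (by simpa using hb)).ne'
  · exact hab
  · exact absurd h (betaNum_lt hab (by simpa using ha)).ne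

theorem betaQuotient_pos (lam : YoungDiagram) (N : ℕ) : 0 < lam.betaQuotient N := by
  refine div_pos (Finset.prod_pos fun a _ => Finset.prod_pos fun b hb => ?_)
    (Finset.prod_pos fun a _ => by exact_mod_cast Nat.factorial_pos _)
  split_ifs with hab
  · exact sub_pos.2 (Nat.cast_lt.2 (betaNum_lt hab (Finset.mem_range.1 hb)))
  · exact one_pos

theorem betaNum_removeCorner (h : lam.rowLen (i + 1) < lam.rowLen i) :
    (lam.removeCorner i).betaNum N =
      Function.update (lam.betaNum N) i (lam.betaNum N i - 1) := by
  funext a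
  simp only [betaNum, rowLen_removeCorner h]
  by_cases ha : a = i
  · subst ha
    simp
    omega
  · simp [ha, betaNum]

theorem betaNum_pos (h : lam.rowLen (i + 1) < lam.rowLen i) : 0 < lam.betaNum N i := by
  unfold betaNum
  omega

/-- The difference product supplies the shift weight, and l_i!/(l_i - 1)! supplies the factor l_i.
-/
theorem betaQuotient_removeCorner (hi : i ∈ lam.cornerRows N) :
    (lam.removeCorner i).betaQuotient N = lam.betaQuotient N * lam.cornerWeight N i := by
  obtain ⟨hiN, h⟩ := mem_cornerRows.1 hi
  have hiN' := Finset.mem_range.2 hiN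
  have hpos := betaNum_pos (N := N) h
  have hl : (fun a => ((lam.removeCorner i).betaNum N a : ℚ)) =
      Function.update (fun a => (lam.betaNum N a : ℚ)) i ((lam.betaNum N i : ℚ) - 1) := by
    funext a
    rw [betaNum_removeCorner h]
    by_cases ha : a = i
    · subst ha
      simp only [Function.update_self]
      push_cast [Nat.cast_sub hpos]
      ring
    · simp [ha]
  have hfac : (∏ a ∈ Finset.range N, ((lam.betaNum N a).factorial : ℚ)) =
      lam.betaNum N i *
        ∏ a ∈ Finset.range N, (((lam.removeCorner i).betaNum N a).factorial : ℚ) := by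
    rw [← Finset.mul_prod_erase _ _ hiN', ← Finset.mul_prod_erase _ _ hiN', ← mul_assoc]
    congr 1
    · rw [betaNum_removeCorner h, Function.update_self]
      exact_mod_cast (Nat.mul_factorial_pred hpos.ne').symm
    · refine Finset.prod_congr rfl fun a ha => ?_
      rw [betaNum_removeCorner h, Function.update_of_ne (Finset.ne_of_mem_erase ha)]
  have hne : (lam.betaNum N i : ℚ) ≠ 0 := by exact_mod_cast hpos.ne'
  have hfne : (∏ a ∈ Finset.range N, (((lam.removeCorner i).betaNum N a).factorial : ℚ)) ≠ 0 :=
    Finset.prod_ne_zero_iff.2 fun a _ => by exact_mod_cast Nat.factorial_ne_zero _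
  rw [betaQuotient, hl, diffProd_update_sub_one _ _ (lam.betaNum_injOn N) hiN', betaQuotient, hfac,
    cornerWeight]
  field_simp

/-- A row without a corner has the length of the next row. Then l_i - l_{i+1} = 1 kills a factor of
the product, or, in the last of the N rows, l_i = 0. Sums over corners thus become sums over all
rows, where the moment formulas apply. -/
theorem cornerWeight_eq_zero (hN : lam.rowLen N = 0) (hiN : i < N) (hi : i ∉ lam.cornerRows N) :
    lam.cornerWeight N i = 0 := by
  have h : lam.rowLen (i + 1) = lam.rowLen i := by
    have := lam.rowLen_anti i (i + 1) (by omega)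
    rw [mem_cornerRows] at hi
    omega
  rcases Nat.lt_or_ge (i + 1) N with h1 | h1
  · have hb : lam.betaNum N i = lam.betaNum N (i + 1) + 1 := by
      unfold betaNum
      omega
    rw [cornerWeight, shiftWeight,
      Finset.prod_eq_zero (i := i + 1) (by simp [h1]) (by simp [hb]), mul_zero]
  · obtain rfl : N = i + 1 := by omega
    have hb : lam.betaNum (i + 1) i = 0 := by
      unfold betaNum
      omega
    simp [cornerWeight, hb]

theorem sum_cornerRows (hN : lam.rowLen N = 0) (g : ℕ → ℚ) :
    ∑ i ∈ lam.cornerRows N, lam.cornerWeight N i * g i =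
      ∑ i ∈ Finset.range N, lam.cornerWeight N i * g i := by
  refine Finset.sum_subset (Finset.filter_subset _ _) fun i hi hni => ?_
  rw [cornerWeight_eq_zero hN (Finset.mem_range.1 hi) hni, zero_mul]

/-! ### Content power sums and the moments of the corner weights -/

/-- The sum of the `k`-th powers of the contents of the cells. -/
def contentSum (lam : YoungDiagram) (k : ℕ) : ℚ := ∑ w ∈ lam.cells, (content w : ℚ) ^ k

theorem contentSum_eq_sum_rows (hN : lam.rowLen N = 0) (k : ℕ) :
    lam.contentSum k =
      ∑ i ∈ Finset.range N, ∑ j ∈ Finset.range (lam.rowLen i), ((j : ℚ) - i) ^ k := by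
  rw [contentSum, Finset.sum_finset_product lam.cells (Finset.range N)
    (fun i => Finset.range (lam.rowLen i))]
  · simp [content]
  · rintro ⟨a, b⟩
    rw [mem_cells, mem_iff_lt_rowLen, Finset.mem_range, Finset.mem_range, iff_and_self]
    intro h
    by_contra! hle
    have := lam.rowLen_anti N a hle
    omega

theorem contentSum_zero (lam : YoungDiagram) : lam.contentSum 0 = lam.card := by
  simp [contentSum, YoungDiagram.card]

/-- The removed cell has content (λ_i - 1) - i = l_i - N. -/
theorem contentSum_removeCorner (hi : i ∈ lam.cornerRows N) (k : ℕ) :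
    (lam.removeCorner i).contentSum k =
      lam.contentSum k - ((lam.betaNum N i : ℚ) - N) ^ k := by
  obtain ⟨hiN, h⟩ := mem_cornerRows.1 hi
  have hc : (content (i, lam.rowLen i - 1) : ℚ) = (lam.betaNum N i : ℚ) - N := by
    have : content (i, lam.rowLen i - 1) = (lam.betaNum N i : ℤ) - N := by
      simp only [content, betaNum]
      omega
    rw [this]
    push_cast
    ring
  rw [contentSum, contentSum, cells_removeCorner h,
    ← Finset.add_sum_erase _ _ ((mem_cells _).2 (corner_mem h)), hc]
  ring

theorem cast_rowLen_eq (hiN : i < N) :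
    (lam.rowLen i : ℚ) = (lam.betaNum N i : ℚ) - N + 1 + i := by
  have : lam.rowLen i + N = lam.betaNum N i + 1 + i := by
    unfold betaNum
    omega
  have : (lam.rowLen i : ℚ) + N = lam.betaNum N i + 1 + i := by exact_mod_cast this
  linarith

theorem sum_range_sub (m : ℕ) (x : ℚ) :
    ∑ j ∈ Finset.range m, ((j : ℚ) - x) ^ 1 = (m - x) * (m - x - 1) / 2 - x * (x + 1) / 2 := by
  induction m with
  | zero => simp; ring
  | succ m ih => rw [Finset.sum_range_succ, ih]; push_cast; ring

theorem sum_range_sub_sq (m : ℕ) (x : ℚ) :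
    ∑ j ∈ Finset.range m, ((j : ℚ) - x) ^ 2 =
      (m - x) * (m - x - 1) * (2 * (m - x) - 1) / 6 + x * (x + 1) * (2 * x + 1) / 6 := by
  induction m with
  | zero => simp; ring
  | succ m ih => rw [Finset.sum_range_succ, ih]; push_cast; ring

theorem sum_range_cast (N : ℕ) : ∑ i ∈ Finset.range N, (i : ℚ) = (N : ℚ) * (N - 1) / 2 := by
  induction N with
  | zero => simp
  | succ m ih => rw [Finset.sum_range_succ, ih]; push_cast; ring

theorem contentSum_zero_eq (hN : lam.rowLen N = 0) :
    lam.contentSum 0 = ∑ i ∈ Finset.range N, (lam.betaNum N i : ℚ) - (N : ℚ) * (N - 1) / 2 := by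
  have h : ∀ i ∈ Finset.range N, ∑ j ∈ Finset.range (lam.rowLen i), ((j : ℚ) - i) ^ 0 =
      (lam.betaNum N i : ℚ) + (1 - N) + i := by
    intro i hi
    simp only [pow_zero, Finset.sum_const, Finset.card_range, nsmul_eq_mul, mul_one]
    rw [cast_rowLen_eq (Finset.mem_range.1 hi)]
    ring
  rw [contentSum_eq_sum_rows hN, Finset.sum_congr rfl h, Finset.sum_add_distrib,
    Finset.sum_add_distrib, sum_range_cast]
  simp
  ring

theorem sum_range_mul_add_one (N : ℕ) :
    ∑ i ∈ Finset.range N, (i : ℚ) * (i + 1) / 2 = (N : ℚ) * (N - 1) * (N + 1) / 6 := by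
  induction N with
  | zero => simp
  | succ m ih => rw [Finset.sum_range_succ, ih]; push_cast; ring

theorem sum_range_mul_mul (N : ℕ) :
    ∑ i ∈ Finset.range N, (i : ℚ) * (i + 1) * (2 * i + 1) / 6 =
      (N : ℚ) ^ 2 * (N - 1) * (N + 1) / 12 := by
  induction N with
  | zero => simp
  | succ m ih => rw [Finset.sum_range_succ, ih]; push_cast; ring

theorem contentSum_one_eq (hN : lam.rowLen N = 0) :
    lam.contentSum 1 = (∑ i ∈ Finset.range N, (lam.betaNum N i : ℚ) ^ 2) / 2
      - (2 * N - 1) / 2 * ∑ i ∈ Finset.range N, (lam.betaNum N i : ℚ)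
      + (N : ℚ) ^ 2 * (N - 1) / 2 - (N : ℚ) * (N - 1) * (N + 1) / 6 := by
  have h : ∀ i ∈ Finset.range N, ∑ j ∈ Finset.range (lam.rowLen i), ((j : ℚ) - i) ^ 1 =
      1 / 2 * (lam.betaNum N i : ℚ) ^ 2 - (2 * N - 1) / 2 * (lam.betaNum N i : ℚ)
        + (N : ℚ) * (N - 1) / 2 - (i : ℚ) * (i + 1) / 2 := by
    intro i hi
    rw [sum_range_sub, cast_rowLen_eq (Finset.mem_range.1 hi)]
    ring
  rw [contentSum_eq_sum_rows hN, Finset.sum_congr rfl h, Finset.sum_sub_distrib,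
    Finset.sum_add_distrib, Finset.sum_sub_distrib, ← Finset.mul_sum, ← Finset.mul_sum,
    sum_range_mul_add_one, Finset.sum_const, Finset.card_range, nsmul_eq_mul]
  ring

theorem contentSum_two_eq (hN : lam.rowLen N = 0) :
    lam.contentSum 2 = (∑ i ∈ Finset.range N, (lam.betaNum N i : ℚ) ^ 3) / 3
      - (2 * N - 1) / 2 * ∑ i ∈ Finset.range N, (lam.betaNum N i : ℚ) ^ 2
      + (6 * (N : ℚ) ^ 2 - 6 * N + 1) / 6 * ∑ i ∈ Finset.range N, (lam.betaNum N i : ℚ)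
      - (N : ℚ) ^ 2 * (N - 1) * (2 * N - 1) / 6 + (N : ℚ) ^ 2 * (N - 1) * (N + 1) / 12 := by
  have h : ∀ i ∈ Finset.range N, ∑ j ∈ Finset.range (lam.rowLen i), ((j : ℚ) - i) ^ 2 =
      1 / 3 * (lam.betaNum N i : ℚ) ^ 3 - (2 * N - 1) / 2 * (lam.betaNum N i : ℚ) ^ 2
        + (6 * (N : ℚ) ^ 2 - 6 * N + 1) / 6 * (lam.betaNum N i : ℚ)
        - (N : ℚ) * (N - 1) * (2 * N - 1) / 6 + (i : ℚ) * (i + 1) * (2 * i + 1) / 6 := by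
    intro i hi
    rw [sum_range_sub_sq, cast_rowLen_eq (Finset.mem_range.1 hi)]
    ring
  rw [contentSum_eq_sum_rows hN, Finset.sum_congr rfl h, Finset.sum_add_distrib,
    Finset.sum_sub_distrib, Finset.sum_add_distrib, Finset.sum_sub_distrib, ← Finset.mul_sum,
    ← Finset.mul_sum, ← Finset.mul_sum, sum_range_mul_mul, Finset.sum_const, Finset.card_range,
    nsmul_eq_mul]
  ring

theorem sum_cornerWeight (hN : lam.rowLen N = 0) :
    ∑ i ∈ lam.cornerRows N, lam.cornerWeight N i = lam.card := by
  have h := sum_cornerRows hN fun _ => 1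
  simp only [mul_one] at h
  rw [h, ← contentSum_zero, contentSum_zero_eq hN]
  simp only [cornerWeight]
  rw [sum_mul_shiftWeight _ _ (lam.betaNum_injOn N), Finset.card_range]

theorem sum_cornerWeight_mul (hN : lam.rowLen N = 0) :
    ∑ i ∈ lam.cornerRows N, lam.cornerWeight N i * ((lam.betaNum N i : ℚ) - N) =
      2 * lam.contentSum 1 := by
  have hinj := lam.betaNum_injOn N
  have h : ∀ i ∈ Finset.range N, lam.cornerWeight N i * ((lam.betaNum N i : ℚ) - N) =
      (lam.betaNum N i : ℚ) ^ 2 *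
          shiftWeight (fun i => (lam.betaNum N i : ℚ)) (Finset.range N) i
        - N * ((lam.betaNum N i : ℚ) *
          shiftWeight (fun i => (lam.betaNum N i : ℚ)) (Finset.range N) i) := by
    intro i _
    rw [cornerWeight]
    ring
  rw [sum_cornerRows hN, Finset.sum_congr rfl h, Finset.sum_sub_distrib, ← Finset.mul_sum,
    sum_mul_shiftWeight _ _ hinj, sum_sq_mul_shiftWeight _ _ hinj, contentSum_one_eq hN,
    Finset.card_range]
  ring

/-- The square of the sum of the beta numbers in the third moment is what produces the term
quadratic in n. -/
theorem sum_cornerWeight_mul_sq (hN : lam.rowLen N = 0) :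
    ∑ i ∈ lam.cornerRows N, lam.cornerWeight N i * ((lam.betaNum N i : ℚ) - N) ^ 2 =
      3 * lam.contentSum 2 - (lam.card : ℚ) * (lam.card - 1) / 2 := by
  have hinj := lam.betaNum_injOn N
  have h : ∀ i ∈ Finset.range N, lam.cornerWeight N i * ((lam.betaNum N i : ℚ) - N) ^ 2 =
      (lam.betaNum N i : ℚ) ^ 3 *
          shiftWeight (fun i => (lam.betaNum N i : ℚ)) (Finset.range N) i
        - 2 * N * ((lam.betaNum N i : ℚ) ^ 2 *
          shiftWeight (fun i => (lam.betaNum N i : ℚ)) (Finset.range N) i)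
        + (N : ℚ) ^ 2 * ((lam.betaNum N i : ℚ) *
          shiftWeight (fun i => (lam.betaNum N i : ℚ)) (Finset.range N) i) := by
    intro i _
    rw [cornerWeight]
    ring
  rw [sum_cornerRows hN, Finset.sum_congr rfl h, Finset.sum_add_distrib, Finset.sum_sub_distrib,
    ← Finset.mul_sum, ← Finset.mul_sum, sum_mul_shiftWeight _ _ hinj,
    sum_sq_mul_shiftWeight _ _ hinj, sum_cube_mul_shiftWeight _ _ hinj, contentSum_two_eq hN,
    ← contentSum_zero, contentSum_zero_eq hN, Finset.card_range]
  ring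

theorem rowLen_removeCorner_eq_zero (hN : lam.rowLen N = 0) (i : ℕ) :
    (lam.removeCorner i).rowLen N = 0 := by
  by_contra h
  have h1 : (N, 0) ∈ lam.removeCorner i := mem_iff_lt_rowLen.2 (by omega)
  have h2 := mem_iff_lt_rowLen.1 ((removeCorner_le : lam.removeCorner i ≤ lam) h1)
  omega

theorem exists_rowLen_eq_zero (lam : YoungDiagram) : ∃ N, lam.rowLen N = 0 := by
  refine ⟨lam.colLen 0, ?_⟩
  by_contra h
  have h1 : (lam.colLen 0, 0) ∈ lam := mem_iff_lt_rowLen.2 (by omega)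
  exact lt_irrefl _ (mem_iff_lt_colLen.1 h1)

theorem eq_bot_of_card_eq_zero (h : lam.card = 0) : lam = ⊥ := by
  ext1
  simpa [YoungDiagram.card] using h

end YoungDiagram

/-! ### Recursions for the number of tableaux and for the polynomial -/

open YoungDiagram

theorem numStandardTableaux_eq_sum_removeCorner {lam : YoungDiagram} {N : ℕ}
    (hN : lam.rowLen N = 0) (h0 : lam.card ≠ 0) :
    numStandardTableaux lam =
      ∑ i ∈ lam.cornerRows N, numStandardTableaux (lam.removeCorner i) := by
  simp only [← numSkewTableaux_bot]
  exact numSkewTableaux_eq_sum_removeCorner hN fun h => h0 (by rw [← h]; rfl)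

/-- The number of standard tableaux is proportional to `n!` times the beta quotient. -/
theorem numStandardTableaux_mul_betaQuotient_bot (n N : ℕ) (lam : YoungDiagram)
    (hn : lam.card = n) (hN : lam.rowLen N = 0) :
    (numStandardTableaux lam : ℚ) * (⊥ : YoungDiagram).betaQuotient N =
      n.factorial * lam.betaQuotient N := by
  induction n generalizing lam with
  | zero =>
    obtain rfl := eq_bot_of_card_eq_zero hn
    simp [numStandardTableaux, StandardFilling.card_empty]
  | succ n ih =>
    -- The quotient of the empty diagram is carried as an unevaluated constant; only its positivity
    -- matters later, when it is cancelled.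
    rw [numStandardTableaux_eq_sum_removeCorner hN (by omega), Nat.cast_sum, Finset.sum_mul]
    have h : ∀ i ∈ lam.cornerRows N,
        (numStandardTableaux (lam.removeCorner i) : ℚ) * (⊥ : YoungDiagram).betaQuotient N =
          n.factorial * lam.betaQuotient N * lam.cornerWeight N i := by
      intro i hi
      have hcard := card_removeCorner_add_one (mem_cornerRows.1 hi).2
      rw [ih _ (by omega) (rowLen_removeCorner_eq_zero hN i), betaQuotient_removeCorner hi,
        mul_assoc]
    rw [Finset.sum_congr rfl h, ← Finset.mul_sum, sum_cornerWeight hN, hn, Nat.factorial_succ]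
    push_cast
    ring

theorem numStandardTableaux_pos (lam : YoungDiagram) : 0 < numStandardTableaux lam := by
  obtain ⟨N, hN⟩ := lam.exists_rowLen_eq_zero
  have h := numStandardTableaux_mul_betaQuotient_bot _ N lam rfl hN
  have h1 : (0 : ℚ) < lam.card.factorial * lam.betaQuotient N :=
    mul_pos (by exact_mod_cast Nat.factorial_pos _) (lam.betaQuotient_pos N)
  rw [← h] at h1
  exact_mod_cast pos_of_mul_pos_left h1 (betaQuotient_pos _ _).le

/-- Dividing the formulas for the two shapes leaves only the ratio of the beta quotients. Thus w_i/n
is the probability that a uniform standard tableau has n in the corner of row i. -/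
theorem card_mul_numStandardTableaux_removeCorner {lam : YoungDiagram} {N i : ℕ}
    (hN : lam.rowLen N = 0) (hi : i ∈ lam.cornerRows N) :
    (lam.card : ℚ) * numStandardTableaux (lam.removeCorner i) =
      numStandardTableaux lam * lam.cornerWeight N i := by
  have hcard := card_removeCorner_add_one (mem_cornerRows.1 hi).2
  have h1 := numStandardTableaux_mul_betaQuotient_bot _ N lam rfl hN
  have h2 := numStandardTableaux_mul_betaQuotient_bot _ N (lam.removeCorner i) rfl
    (rowLen_removeCorner_eq_zero hN i)
  rw [betaQuotient_removeCorner hi] at h2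
  rw [← hcard, Nat.factorial_succ] at h1
  refine mul_right_cancel₀ ((⊥ : YoungDiagram).betaQuotient_pos N).ne' ?_
  rw [mul_assoc, h2, mul_right_comm, h1, ← hcard]
  push_cast
  ring

/-- The polynomial in the content power sums of the diagram that gives
`(n)_3 f^{λ/(3)} / f^λ`. -/
def threeRowPoly (lam : YoungDiagram) : ℚ :=
  (lam.card : ℚ) ^ 3 / 6 + (lam.card - 2) * lam.contentSum 1 + lam.contentSum 2
    - (lam.card : ℚ) ^ 2 + 5 / 6 * lam.card

/-- Replacing n, p₁, p₂ by n - 1, p₁ - c_i, p₂ - c_i² makes the summand a combination of w_i, w_i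
c_i and w_i c_i², whose sums are known. -/
theorem card_mul_sum_threeRowPoly {lam : YoungDiagram} {N : ℕ} (hN : lam.rowLen N = 0) :
    lam.card * ∑ i ∈ lam.cornerRows N,
        numStandardTableaux (lam.removeCorner i) * threeRowPoly (lam.removeCorner i) =
      ((lam.card : ℚ) - 3) * (numStandardTableaux lam * threeRowPoly lam) := by
  have h : ∀ i ∈ lam.cornerRows N,
      (lam.card : ℚ) * (numStandardTableaux (lam.removeCorner i) *
          threeRowPoly (lam.removeCorner i)) =
        numStandardTableaux lam *
          ((((lam.card : ℚ) - 1) ^ 3 / 6 + (lam.card - 3) * lam.contentSum 1 + lam.contentSum 2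
              - ((lam.card : ℚ) - 1) ^ 2 + 5 / 6 * (lam.card - 1)) * lam.cornerWeight N i
            - (lam.card - 3) * (lam.cornerWeight N i * ((lam.betaNum N i : ℚ) - N))
            - lam.cornerWeight N i * ((lam.betaNum N i : ℚ) - N) ^ 2) := by
    intro i hi
    have hcard : ((lam.removeCorner i).card : ℚ) = lam.card - 1 := by
      rw [← card_removeCorner_add_one (mem_cornerRows.1 hi).2]
      push_cast
      ring
    rw [← mul_assoc, card_mul_numStandardTableaux_removeCorner hN hi, threeRowPoly, hcard,
      contentSum_removeCorner hi, contentSum_removeCorner hi]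
    ring
  rw [Finset.mul_sum, Finset.sum_congr rfl h, ← Finset.mul_sum, Finset.sum_sub_distrib,
    Finset.sum_sub_distrib, ← Finset.mul_sum, ← Finset.mul_sum, sum_cornerWeight hN,
    sum_cornerWeight_mul hN, sum_cornerWeight_mul_sq hN, threeRowPoly]
  ring

/-! ### Diagrams with three cells -/

theorem cells_oneRow_three : (oneRow 3).cells = {(0, 0), (0, 1), (0, 2)} := by
  rfl

theorem oneRow_three_le_iff {lam : YoungDiagram} : oneRow 3 ≤ lam ↔ (0, 2) ∈ lam := by
  rw [← cells_subset_iff, cells_oneRow_three]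
  simp only [Finset.insert_subset_iff, Finset.singleton_subset_iff, mem_cells]
  exact ⟨fun h => h.2.2, fun h => ⟨lam.up_left_mem le_rfl (by omega) h,
    lam.up_left_mem le_rfl (by omega) h, h⟩⟩

theorem numStandardTableaux_oneRow_three : numStandardTableaux (oneRow 3) = 1 := by
  have hex : ∀ c : ℕ × ℕ, c ∈ (oneRow 3).cells ↔ c.1 = 0 ∧ c.2 < 3 := by
    rintro ⟨a, b⟩
    rw [cells_oneRow_three]
    simp
    omega
  have hcard : (oneRow 3).cells.card = 3 := rfl
  rw [numStandardTableaux, Nat.card_eq_one_iff_unique]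
  refine ⟨⟨fun T T' => ?_⟩, ⟨⟨fun c => if c.1 = 0 ∧ c.2 < 3 then c.2 + 1 else 0,
    ⟨?_, ?_, ?_⟩, ?_, ?_, ?_⟩⟩⟩
  · have key : ∀ S : StandardFilling (oneRow 3).cells,
        S.entry (0, 0) = 1 ∧ S.entry (0, 1) = 2 ∧ S.entry (0, 2) = 3 := by
      intro S
      have h0 : ((0, 0) : ℕ × ℕ) ∈ (oneRow 3).cells := by simp [hex]
      have h1 : ((0, 1) : ℕ × ℕ) ∈ (oneRow 3).cells := by simp [hex]
      have h2 : ((0, 2) : ℕ × ℕ) ∈ (oneRow 3).cells := by simp [hex]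
      have h3 := S.row_lt (by omega) h0 h1
      have h4 := S.row_lt (by omega) h1 h2
      have h5 := (S.bijOn.mapsTo h0).1
      have h6 := (S.bijOn.mapsTo h2).2
      omega
    obtain ⟨h0, h1, h2⟩ := key T
    obtain ⟨h0', h1', h2'⟩ := key T'
    ext c
    by_cases hc : c ∈ (oneRow 3).cells
    · rw [cells_oneRow_three] at hc
      simp only [Finset.mem_insert, Finset.mem_singleton] at hc
      rcases hc with rfl | rfl | rfl
      · rw [h0, h0']
      · rw [h1, h1']
      · rw [h2, h2']
    · rw [T.zeros hc, T'.zeros hc]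
  · intro c hc
    have hc := (hex c).1 hc
    simp only [hc, and_self, if_true, hcard, Set.mem_Icc]
    omega
  · rintro ⟨a, b⟩ hc ⟨a', b'⟩ hc' h
    have hc := (hex _).1 hc
    have hc' := (hex _).1 hc'
    simp only [if_pos hc, if_pos hc'] at h
    simp only [Prod.mk.injEq] at hc hc' ⊢
    omega
  · intro k hk
    simp only [hcard, Set.mem_Icc] at hk
    have hk' : (0, k - 1).1 = 0 ∧ (0, k - 1).2 < 3 := ⟨rfl, by simp only; omega⟩
    refine ⟨(0, k - 1), (hex _).2 hk', ?_⟩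
    exact (if_pos hk').trans (Nat.sub_add_cancel hk.1)
  · intro i j₁ j₂ hj h1 h2
    have h1 := (hex _).1 h1
    have h2 := (hex _).1 h2
    simp only [if_pos h1, if_pos h2]
    omega
  · intro i₁ i₂ j hi h1 h2
    have h1 := (hex _).1 h1
    have h2 := (hex _).1 h2
    simp only at h1 h2
    omega
  · intro c hc
    rw [hex] at hc
    exact if_neg hc

theorem numSkewTableaux_self (lam : YoungDiagram) : numSkewTableaux lam lam = 1 := by
  rw [numSkewTableaux, if_pos le_rfl, Finset.sdiff_self, StandardFilling.card_empty]

theorem threeRowPoly_oneRow_three : threeRowPoly (oneRow 3) = 6 := by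
  rw [threeRowPoly, contentSum, contentSum, YoungDiagram.card, cells_oneRow_three]
  norm_num [content]

theorem cells_of_card_eq_three {lam : YoungDiagram} (h : lam.card = 3) :
    lam = oneRow 3 ∨ lam.cells = {(0, 0), (0, 1), (1, 0)} ∨
      lam.cells = {(0, 0), (1, 0), (2, 0)} := by
  have hsub : ∀ s : Finset (ℕ × ℕ), s ⊆ lam.cells → s.card = 3 → lam.cells = s := fun s hs hc =>
    (Finset.eq_of_subset_of_card_le hs (by rw [hc]; exact h.le)).symm
  have hlt : ∀ s : Finset (ℕ × ℕ), lam.cells ⊆ s → ¬ s.card < 3 := fun s hs hc => by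
    have := Finset.card_le_card hs
    have : lam.cells.card = 3 := h
    omega
  by_cases h02 : (0, 2) ∈ lam
  · left
    exact YoungDiagram.ext (hsub _ (cells_subset_iff.2 (oneRow_three_le_iff.2 h02)) rfl)
  have h00 : (0, 0) ∈ lam := by
    by_contra h00
    refine hlt ∅ (fun c hc => absurd (lam.up_left_mem (Nat.zero_le _) (Nat.zero_le _) hc) h00) (by simp)
  have hcol : ∀ a b, (a, b) ∈ lam → b < 2 := by
    intro a b hab
    by_contra! hb
    exact h02 (lam.up_left_mem (Nat.zero_le _) hb hab)
  by_cases h01 : (0, 1) ∈ lam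
  · right; left
    by_cases h10 : (1, 0) ∈ lam
    · exact hsub _ (by simp [Finset.insert_subset_iff, h00, h01, h10]) rfl
    · refine absurd (by decide) (hlt {(0, 0), (0, 1)} ?_)
      rintro ⟨a, b⟩ hab
      have h1 := hcol a b hab
      have h2 : ¬ 1 ≤ a := fun ha => h10 (lam.up_left_mem ha (Nat.zero_le _) hab)
      simp
      omega
  · right; right
    have hb0 : ∀ a b, (a, b) ∈ lam → b = 0 := by
      intro a b hab
      by_contra hb
      exact h01 (lam.up_left_mem (Nat.zero_le _) (by omega) hab)
    by_cases h20 : (2, 0) ∈ lam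
    · have h10 : (1, 0) ∈ lam := lam.up_left_mem (by omega) le_rfl h20
      exact hsub _ (by simp [Finset.insert_subset_iff, h00, h10, h20]) rfl
    · refine absurd (by decide) (hlt {(0, 0), (1, 0)} ?_)
      rintro ⟨a, b⟩ hab
      have h1 := hb0 a b hab
      have h2 : ¬ 2 ≤ a := fun ha => h20 (lam.up_left_mem ha (Nat.zero_le _) hab)
      simp
      omega

/-- The shapes (2,1) and (1,1,1) have (p₁, p₂) = (0, 2) and (-3, 5), and both are zeros of the
polynomial at n = 3. -/
theorem threeRowPoly_eq_zero {lam : YoungDiagram} (h : lam.card = 3) (hne : lam ≠ oneRow 3) :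
    threeRowPoly lam = 0 := by
  rcases (cells_of_card_eq_three h).resolve_left hne with hc | hc <;>
  · rw [threeRowPoly, contentSum, contentSum, YoungDiagram.card, hc]
    norm_num [content]

/-! ### The induction on size and the final formula -/

theorem descFactorial_three_mul_numSkewTableaux (n : ℕ) (lam : YoungDiagram)
    (hn : lam.card = n) :
    (n : ℚ) * (n - 1) * (n - 2) * numSkewTableaux lam (oneRow 3) =
      numStandardTableaux lam * threeRowPoly lam := by
  induction n generalizing lam with
  | zero =>
    obtain rfl := eq_bot_of_card_eq_zero hn
    simp [threeRowPoly, contentSum, YoungDiagram.card]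
  | succ n ih =>
    have hcard3 : (oneRow 3).card = 3 := rfl
    by_cases h3 : lam = oneRow 3
    · subst h3
      have : n = 2 := by omega
      subst this
      rw [numSkewTableaux_self, numStandardTableaux_oneRow_three, threeRowPoly_oneRow_three]
      norm_num
    -- Here the diagram has n + 1 cells, and the factor (n + 1) - 3 = n - 2 to be cancelled below
    -- vanishes at size three.
    by_cases hn2 : n = 2
    · subst hn2
      have hnle : ¬ oneRow 3 ≤ lam := fun hle =>
        h3 (YoungDiagram.ext (Finset.eq_of_subset_of_card_le (cells_subset_iff.2 hle)
          (hn.trans hcard3.symm).le).symm)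
      rw [threeRowPoly_eq_zero hn h3, numSkewTableaux, if_neg hnle]
      simp
    obtain ⟨N, hN⟩ := lam.exists_rowLen_eq_zero
    have hsum : ((n : ℚ) * (n - 1) * (n - 2)) * numSkewTableaux lam (oneRow 3) =
        ∑ i ∈ lam.cornerRows N,
          numStandardTableaux (lam.removeCorner i) * threeRowPoly (lam.removeCorner i) := by
      rw [numSkewTableaux_eq_sum_removeCorner hN (Ne.symm h3), Nat.cast_sum, Finset.mul_sum]
      refine Finset.sum_congr rfl fun i hi => ih _ ?_
      have := card_removeCorner_add_one (mem_cornerRows.1 hi).2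
      omega
    have hrec := card_mul_sum_threeRowPoly hN
    rw [← hsum, hn] at hrec
    have hne : (n : ℚ) - 2 ≠ 0 := sub_ne_zero.2 (by exact_mod_cast hn2)
    refine mul_left_cancel₀ hne ?_
    push_cast at hrec ⊢
    linear_combination hrec

theorem cp_cons (k : ℕ) (α : List ℕ) (lam : YoungDiagram) :
    (cp (k :: α) lam : ℚ) = lam.contentSum (k - 1) * cp α lam := by
  simp [cp, cpAt, contentSum, relContent, content]

theorem cp_nil (lam : YoungDiagram) : cp [] lam = 1 := by
  simp [cp, cpAt]

theorem cast_descFactorial_three (n : ℕ) :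
    (n.descFactorial 3 : ℚ) = (n : ℚ) * (n - 1) * (n - 2) := by
  rcases n with _ | _ | n
  · simp
  · simp
  · simp only [Nat.descFactorial_succ, Nat.descFactorial_zero, Nat.sub_zero,
      show n + 1 + 1 - 1 = n + 1 by omega, show n + 1 + 1 - 2 = n by omega]
    push_cast
    ring

theorem mainTheorem4 (n : ℕ) (lam : YoungDiagram) (hlam : lam.card = n) :
    0 < numStandardTableaux lam ∧
    (n.descFactorial 3 : ℚ) * (numSkewTableaux lam (oneRow 3) : ℚ) /
        (numStandardTableaux lam : ℚ) =
      (1 / 6 : ℚ) * (cp [1, 1, 1] lam : ℚ) + (cp [2, 1] lam : ℚ) + (cp [3] lam : ℚ)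
        - (cp [1, 1] lam : ℚ) - 2 * (cp [2] lam : ℚ) + (5 / 6 : ℚ) * (cp [1] lam : ℚ) := by
  have hpos := numStandardTableaux_pos lam
  have hne : (numStandardTableaux lam : ℚ) ≠ 0 := by exact_mod_cast hpos.ne'
  refine ⟨hpos, ?_⟩
  rw [cast_descFactorial_three, descFactorial_three_mul_numSkewTableaux n lam hlam,
    mul_div_cancel_left₀ _ hne, threeRowPoly]
  simp only [cp_cons, cp_nil, Nat.sub_self, contentSum_zero, show 2 - 1 = 1 from rfl,
    show 3 - 1 = 2 from rfl]
  push_cast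
  ring
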